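/- **Setting.** Fix $d\ge 0$. A (locally finite) cell complex $K$ in $\mathbb R^d$ is a collection of subsets (closed cells) of $\mathbb R^d$, each homeomorphic to a closed unit ball of some dimension $p\le d$, such that the boundary of each cell is a union of lower-dimensional cells of $K$ (its faces), any two cells intersect in a (possibly empty) union of common faces (a cell counting as a face of itself), and every point of $\mathbb R^d$ has a neighborhood meeting only finitely many cells. A filter on $K$ is a function $f\colon K\to\mathbb R$ with $f(\sigma)\le f(\tau)$ whenever $\sigma$ is a face of $\tau$; write $K_t$ for the union of the cells with $f\le t$. Given a full-dimensional lattice $\Lambda\subseteq\mathbb R^d$, $K$ and $f$ are $\Lambda$-periodic if $\sigma+u\in K$ and $f(\sigma+u)=f(\sigma)$ for all $\sigma\in K$, $u\in\Lambda$. **Periodic merge tree.** Let $\phi\colon\mathbb R^d\to\mathbb R^d/\Lambda$ be the projection and $(K/\Lambda)_t=\phi(K_t)$. The periodic merge tree $M(f,\Lambda)$ is the quotient of $\{(x,s)\in(\mathbb R^d/\Lambda)\times\mathbb R : x\in(K/\Lambda)_s\}$ that identifies $(x,s)$ and $(y,s)$ when $x,y$ lie in the same connected component of $(K/\Lambda)_s$,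 with the quotient topology. Its points are thus connected components $\Gamma$ of sublevel sets; the height $h(\Gamma)$ is the corresponding $s$; and $B$ covers $A$ if $h(A)\le h(B)$ and $A\subseteq B$. The shadows of $\Gamma$ are the connected components of $\phi^{-1}(\Gamma)$, and $\Lambda_\Gamma=\{u\in\Lambda : c+u=c \text{ for every shadow } c \text{ of } \Gamma\}$. The frequency of $\Gamma$ is the monomial $$F(\Gamma)=\frac{\mathrm{vol}_p(\Lambda_\Gamma)}{\mathrm{vol}_d(\Lambda)}\,\nu_{d-p}\,R^{d-p},\qquad p=\dim\Lambda_\Gamma,$$ where $\mathrm{vol}_p$ is the $p$-dimensional volume of a unit cell of the lattice and $\nu_q$ is the volume of the unit ball in $\mathbb R^q$. Monomials are ordered by exponent first and then by coefficient. A *periodic merge tree* is any $M(f,\Lambda)$ with its height and frequency functions, for some $K$, $\Lambda$, $f$ as above in $\mathbb R^d$. **Interleaving distance.** For $\varepsilon\ge0$, continuous maps $\varphi\colon M\to M'$, $\psi\colon M'\to M$ between periodic merge trees (or subtrees of them) are $\varepsilon$-compatible if both raise heights by exactly $\varepsilon$, $\psi\varphi(\Gamma)$ covers $\Gamma$ and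 $\varphi\psi(\Gamma')$ covers $\Gamma'$, and $F'(\varphi(\Gamma))\le F(\Gamma)$, $F(\psi(\Gamma'))\le F'(\Gamma')$, for all $\Gamma\in M,\Gamma'\in M'$. The interleaving distance $D(M,M')\in[0,\infty]$ is the infimum of the $\varepsilon\ge 0$ for which $\varepsilon$-compatible maps exist ($\inf\emptyset=\infty$). **Splintering.** Write $M_\Gamma$ for the subtree of points covered by $\Gamma$. We say $M'$ splinters $M$ if there is a continuous, height-preserving surjection $\omega\colon M'\to M$ such that for every $\Gamma\in M$ the fiber $\omega^{-1}(\Gamma)$ is finite and for all $A,B\in\omega^{-1}(\Gamma)$: $D(M'_A,M'_B)=0$; $\omega(M'_A)=\omega(M'_B)=M_\Gamma$; and $F'(A)=F'(B)=F(\Gamma)/\#\omega^{-1}(\Gamma)$. Periodic merge trees $M,N$ are equivalent, $M\simeq N$, if some periodic merge tree splinters both; $[M]$ is the class of periodic merge trees equivalent to $M$. The interleaving pseudo-distance is $$J([M],[M'])=\inf\Big\{\sum_{i=1}^k D(M_i,M_i') : k\ge1,\ M_1\in[M],\ M_k'\in[M'],\ M_i'\simeq M_{i+1}\ (1\le i<k)\Big\}.$$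 **Theorem (Invariance of equivalence classes of periodic merge trees).** Let $\Lambda\subseteq\mathbb R^d$ be a $d$-dimensional lattice, $K$ a locally finite $\Lambda$-periodic cell complex in $\mathbb R^d$, $f\colon K\to\mathbb R$ a $\Lambda$-periodic filter, and $\Lambda',\Lambda''\subseteq\Lambda$ two $d$-dimensional sublattices. Then $M(f,\Lambda')\simeq M(f,\Lambda'')$, and $$J\big([M(f,\Lambda')],[M(f,\Lambda'')]\big)=0.$$ -/

import Mathlib

open scoped NNReal ENNReal Pointwise

noncomputable section

namespace PeriodicMerge

/-! ### Cell complexes and filters -/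

/-- A locally finite cell complex in `ℝ^d`: a collection of subsets of `ℝ^d` (the closed cells),
each with its dimension and its boundary. A cell of dimension `p` is homeomorphic to the closed unit
ball of `ℝ^p`, its boundary being the image of the unit sphere. -/
structure CellComplex (d : ℕ) where
  /-- the closed cells -/
  cells : Set (Set (EuclideanSpace ℝ (Fin d)))
  /-- the dimension of a cell -/
  dim : cells → ℕ
  /-- the boundary of a cell -/
  bd : cells → Set (EuclideanSpace ℝ (Fin d))
  dim_le : ∀ σ, dim σ ≤ d
  exists_homeomorph : ∀ σ : cells,
    ∃ h : Metric.closedBall (0 : EuclideanSpace ℝ (Fin (dim σ))) 1 ≃ₜ σ.1,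
      bd σ = (fun x => (h x : EuclideanSpace ℝ (Fin d))) ''
        {x | (x : EuclideanSpace ℝ (Fin (dim σ))) ∈ Metric.sphere 0 1}
  /-- the boundary of a cell is a union of lower-dimensional cells of the complex -/
  bd_eq : ∀ σ : cells,
    bd σ = ⋃ ρ ∈ {ρ : cells | dim ρ < dim σ ∧ ρ.1 ⊆ bd σ}, ρ.1
  /-- two cells intersect in a (possibly empty) union of common faces; a cell counts here as a face
  of itself -/
  inter_eq : ∀ σ τ : cells, σ.1 ∩ τ.1 =
    ⋃ ρ ∈ {ρ : cells |
      (ρ = σ ∨ (dim ρ < dim σ ∧ ρ.1 ⊆ bd σ)) ∧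
      (ρ = τ ∨ (dim ρ < dim τ ∧ ρ.1 ⊆ bd τ))}, ρ.1
  locallyFinite : LocallyFinite (fun σ : cells => σ.1)

variable {d : ℕ}

/-- `ρ` is a (proper) face of `σ`. -/
def CellComplex.IsFace (K : CellComplex d) (ρ σ : K.cells) : Prop :=
  K.dim ρ < K.dim σ ∧ ρ.1 ⊆ K.bd σ

/-- A filter on `K`: a real function on the cells that does not decrease from a face to a cell. -/
def CellComplex.IsFilter (K : CellComplex d) (f : K.cells → ℝ) : Prop :=
  ∀ σ τ : K.cells, K.IsFace σ τ → f σ ≤ f τ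

/-- The sublevel set `K_t`, as a set of points: the union of the cells of value at most `t`. -/
def CellComplex.sublevel (K : CellComplex d) (f : K.cells → ℝ) (t : ℝ) :
    Set (EuclideanSpace ℝ (Fin d)) :=
  ⋃ σ ∈ {σ : K.cells | f σ ≤ t}, σ.1

/-- `K` is periodic with respect to `Λ`: translates of cells by vectors of `Λ` are cells. -/
def CellComplex.IsPeriodic (K : CellComplex d)
    (Λ : Submodule ℤ (EuclideanSpace ℝ (Fin d))) : Prop :=
  ∀ σ ∈ K.cells, ∀ u ∈ Λ, u +ᵥ σ ∈ K.cells

/-- `f` takes the same value on cells of `K` that are translates of each other by vectors of `Λ`. -/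
def CellComplex.IsPeriodicFun (K : CellComplex d) (f : K.cells → ℝ)
    (Λ : Submodule ℤ (EuclideanSpace ℝ (Fin d))) : Prop :=
  ∀ σ τ : K.cells, ∀ u ∈ Λ, τ.1 = u +ᵥ σ.1 → f τ = f σ

/-- `f` is a `Λ`-periodic filter on the `Λ`-periodic complex `K`. -/
structure CellComplex.IsPeriodicFilter (K : CellComplex d) (f : K.cells → ℝ)
    (Λ : Submodule ℤ (EuclideanSpace ℝ (Fin d))) : Prop where
  isFilter : K.IsFilter f
  isPeriodic : K.IsPeriodic Λ
  isPeriodicFun : K.IsPeriodicFun f Λ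

theorem CellComplex.IsPeriodicFilter.mono {K : CellComplex d} {f : K.cells → ℝ}
    {Λ Λ' : Submodule ℤ (EuclideanSpace ℝ (Fin d))} (h : K.IsPeriodicFilter f Λ) (hle : Λ' ≤ Λ) :
    K.IsPeriodicFilter f Λ' :=
  ⟨h.isFilter, fun σ hσ u hu => h.isPeriodic σ hσ u (hle hu),
    fun σ τ u hu => h.isPeriodicFun σ τ u (hle hu)⟩

/-- The sublevel set `(K/Λ)_t` of the quotient filter `f/Λ`, as a set of points of the torus
`ℝ^d/Λ`: the union of the images of the cells of value at most `t`. -/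
def CellComplex.quotientSublevel (K : CellComplex d) (f : K.cells → ℝ)
    (Λ : Submodule ℤ (EuclideanSpace ℝ (Fin d))) (t : ℝ) : Set (EuclideanSpace ℝ (Fin d) ⧸ Λ) :=
  Λ.mkQ '' K.sublevel f t

/-! ### Merge trees -/

section MergeTree

variable {X : Type} [TopologicalSpace X]

/-- The sublevel space of a family of sublevel sets `S t`, with the topology of `X × ℝ`. -/
def SublevelSpace (S : ℝ → Set X) : Type := {q : X × ℝ // q.1 ∈ S q.2}

instance (S : ℝ → Set X) : TopologicalSpace (SublevelSpace S) :=
  inferInstanceAs (TopologicalSpace {q : X × ℝ // q.1 ∈ S q.2})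

/-- The connected component of `S s` containing `x`, for a point `(x, s)` of the sublevel space. -/
def SublevelSpace.component {S : ℝ → Set X} (q : SublevelSpace S) : Set X :=
  connectedComponentIn (S q.1.2) q.1.1

/-- `(x, s) ∼ (y, t)` if `s = t` and `x`, `y` lie in the same connected component of `S s`. -/
def mergeSetoid (S : ℝ → Set X) : Setoid (SublevelSpace S) where
  r q r := q.1.2 = r.1.2 ∧ q.component = r.component
  iseqv := ⟨fun _ => ⟨rfl, rfl⟩, fun h => ⟨h.1.symm, h.2.symm⟩,
    fun h h' => ⟨h.1.trans h'.1, h.2.trans h'.2⟩⟩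

/-- The merge tree, with the quotient topology. -/
def MergeTree (S : ℝ → Set X) : Type := Quotient (mergeSetoid S)

instance (S : ℝ → Set X) : TopologicalSpace (MergeTree S) :=
  inferInstanceAs (TopologicalSpace (Quotient (mergeSetoid S)))

/-- The height function. -/
def MergeTree.height {S : ℝ → Set X} : MergeTree S → ℝ :=
  Quotient.lift (fun q : SublevelSpace S => q.1.2) fun _ _ h => h.1

/-- The connected component that a point of the merge tree represents. -/
def MergeTree.component {S : ℝ → Set X} : MergeTree S → Set X :=
  Quotient.lift (fun q : SublevelSpace S => q.component) fun _ _ h => h.2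

/-- `b` covers `a`. -/
def MergeTree.Covers {S : ℝ → Set X} (b a : MergeTree S) : Prop :=
  a.height ≤ b.height ∧ a.component ⊆ b.component

end MergeTree

/-! ### Shadow monomials -/

/-- A monomial `coeff * R ^ exp`. -/
@[ext] structure Monomial where
  coeff : ℝ
  exp : ℕ

/-- Monomials are compared by exponent first, and then by coefficient. -/
instance : LE Monomial := ⟨fun m n => m.exp < n.exp ∨ (m.exp = n.exp ∧ m.coeff ≤ n.coeff)⟩

/-- Division of a monomial by a natural number. -/
def Monomial.divNat (m : Monomial) (n : ℕ) : Monomial := ⟨m.coeff / n, m.exp⟩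

/-- The `p`-dimensional volume of a unit cell of a `p`-dimensional lattice `L` in `ℝ^d`: the covolume
of `L` in its real span, with respect to the Lebesgue measure of that Euclidean space. -/
def latticeVolume (L : Submodule ℤ (EuclideanSpace ℝ (Fin d))) : ℝ :=
  ZLattice.covolume
    (L.comap ((Submodule.span ℝ (L : Set (EuclideanSpace ℝ (Fin d)))).subtype.restrictScalars ℤ))
    (stdOrthonormalBasis ℝ (Submodule.span ℝ (L : Set (EuclideanSpace ℝ (Fin d))))).toBasis.addHaar

/-- The volume `ν_q` of the unit ball of `ℝ^q`. -/
def unitBallVolume (q : ℕ) : ℝ :=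
  (MeasureTheory.volume (Metric.ball (0 : EuclideanSpace ℝ (Fin q)) 1)).toReal

/-- `c` is a shadow of `C ⊆ ℝ^d/Λ`: a connected component of the preimage of `C` in `ℝ^d`. -/
def IsShadow (Λ : Submodule ℤ (EuclideanSpace ℝ (Fin d)))
    (C : Set (EuclideanSpace ℝ (Fin d) ⧸ Λ)) (c : Set (EuclideanSpace ℝ (Fin d))) : Prop :=
  ∃ x ∈ Λ.mkQ ⁻¹' C, c = connectedComponentIn (Λ.mkQ ⁻¹' C) x

/-- The periodicity lattice `Λ_C`: the vectors of `Λ` that keep the shadows of `C` invariant. -/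
def periodicityLattice (Λ : Submodule ℤ (EuclideanSpace ℝ (Fin d)))
    (C : Set (EuclideanSpace ℝ (Fin d) ⧸ Λ)) : Submodule ℤ (EuclideanSpace ℝ (Fin d)) :=
  AddSubgroup.toIntSubmodule
    { carrier := {u | u ∈ Λ ∧ ∀ c, IsShadow Λ C c → u +ᵥ c = c}
      zero_mem' := ⟨Λ.zero_mem, fun c _ => zero_vadd _ c⟩
      add_mem' := fun {u v} hu hv =>
        ⟨Λ.add_mem hu.1 hv.1, fun c hc => by rw [add_vadd, hv.2 c hc, hu.2 c hc]⟩
      neg_mem' := fun {u} hu =>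
        ⟨Λ.neg_mem hu.1, fun c hc => by rw [neg_vadd_eq_iff, hu.2 c hc]⟩ }

/-- The shadow monomial `vol_p(Λ_C) / vol_d(Λ) * ν_{d-p} * R^{d-p}`, with `p = dim Λ_C`. -/
def shadowMonomial (Λ : Submodule ℤ (EuclideanSpace ℝ (Fin d)))
    (C : Set (EuclideanSpace ℝ (Fin d) ⧸ Λ)) : Monomial where
  coeff := latticeVolume (periodicityLattice Λ C) / latticeVolume Λ *
    unitBallVolume (d - Module.finrank ℤ (periodicityLattice Λ C))
  exp := d - Module.finrank ℤ (periodicityLattice Λ C)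

/-! ### Periodic merge trees -/

/-- A topological space with a height function, a covering relation and a frequency function. This
is only the common format of periodic merge trees and of their subtrees. -/
structure DecoratedTree where
  Pt : Type
  [top : TopologicalSpace Pt]
  height : Pt → ℝ
  Covers : Pt → Pt → Prop
  freq : Pt → Monomial

attribute [instance] DecoratedTree.top

/-- The merge tree of the quotient filter `f/Λ`, with its height and frequency functions. -/
def decoratedMergeTree (K : CellComplex d) (f : K.cells → ℝ)
    (Λ : Submodule ℤ (EuclideanSpace ℝ (Fin d))) : DecoratedTree where
  Pt := MergeTree (K.quotientSublevel f Λ)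
  height := MergeTree.height
  Covers := MergeTree.Covers
  freq C := shadowMonomial Λ C.component

/-- A periodic merge tree (in dimension `d`) is the decorated merge tree of a `Λ`-periodic filter
on a locally finite `Λ`-periodic complex in `ℝ^d`, for some full-dimensional lattice `Λ`. -/
def PeriodicMergeTree (d : ℕ) : Type 1 :=
  {T : DecoratedTree // ∃ (K : CellComplex d) (f : K.cells → ℝ)
    (Λ : Submodule ℤ (EuclideanSpace ℝ (Fin d))) (_ : DiscreteTopology Λ),
    IsZLattice ℝ Λ ∧ K.IsPeriodicFilter f Λ ∧ T = decoratedMergeTree K f Λ}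

/-- The periodic merge tree of the `Λ`-periodic filter `f` with respect to `Λ`. -/
def perMTree (K : CellComplex d) (f : K.cells → ℝ)
    (Λ : Submodule ℤ (EuclideanSpace ℝ (Fin d))) [hd : DiscreteTopology Λ] [hz : IsZLattice ℝ Λ]
    (hf : K.IsPeriodicFilter f Λ) : PeriodicMergeTree d :=
  ⟨decoratedMergeTree K f Λ, K, f, Λ, hd, hz, hf, rfl⟩

/-! ### Interleaving distance, splintering, interleaving pseudo-distance -/

/-- The subtree with topmost point `C`: the points covered by `C`. -/
def DecoratedTree.subtree (T : DecoratedTree) (C : T.Pt) : DecoratedTree where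
  Pt := {A : T.Pt // T.Covers C A}
  height A := T.height A
  Covers B A := T.Covers B.1 A.1
  freq A := T.freq A

/-- The maps `φ`, `ψ` are `ε`-compatible. -/
structure IsCompatible (T T' : DecoratedTree) (ε : ℝ≥0) (φ : T.Pt → T'.Pt) (ψ : T'.Pt → T.Pt) :
    Prop where
  continuous_left : Continuous φ
  continuous_right : Continuous ψ
  height_left : ∀ C, T'.height (φ C) = T.height C + ε
  height_right : ∀ C', T.height (ψ C') = T'.height C' + ε
  covers_left : ∀ C, T.Covers (ψ (φ C)) C
  covers_right : ∀ C', T'.Covers (φ (ψ C')) C'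
  freq_left : ∀ C, T'.freq (φ C) ≤ T.freq C
  freq_right : ∀ C', T.freq (ψ C') ≤ T'.freq C'

/-- The interleaving distance: the infimum of the `ε ≥ 0` for which there are `ε`-compatible maps
(`∞` if there is no such `ε`). -/
def interleavingDist (T T' : DecoratedTree) : ℝ≥0∞ :=
  ⨅ ε ∈ {ε : ℝ≥0 | ∃ φ ψ, IsCompatible T T' ε φ ψ}, (ε : ℝ≥0∞)

/-- `T'` splinters `T`. -/
def Splinters (T' T : DecoratedTree) : Prop :=
  ∃ ω : T'.Pt → T.Pt, Continuous ω ∧ Function.Surjective ω ∧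
    (∀ A, T.height (ω A) = T'.height A) ∧
    ∀ C : T.Pt, (ω ⁻¹' {C}).Finite ∧ ∀ A ∈ ω ⁻¹' {C}, ∀ B ∈ ω ⁻¹' {C},
      interleavingDist (T'.subtree A) (T'.subtree B) = 0 ∧
      ω '' {X | T'.Covers A X} = {Y | T.Covers C Y} ∧
      ω '' {X | T'.Covers B X} = {Y | T.Covers C Y} ∧
      T'.freq A = T'.freq B ∧
      T'.freq B = (T.freq C).divNat (ω ⁻¹' {C}).ncard

/-- Two periodic merge trees are equivalent if some periodic merge tree splinters both. -/
def Equivalent (M N : PeriodicMergeTree d) : Prop :=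
  ∃ T : PeriodicMergeTree d, Splinters T.1 M.1 ∧ Splinters T.1 N.1

/-- The class `[M]` of the periodic merge trees equivalent to `M`. -/
def equivClass (M : PeriodicMergeTree d) : Set (PeriodicMergeTree d) :=
  {N | Equivalent N M}

/-- The interleaving pseudo-distance: the infimum of `∑ i, D(M i, M' i)` over all finite sequences
with `M 0` in the first class, the last `M' i` in the second class, and `M' i` equivalent to
`M (i+1)`. -/
def interleavingPseudoDist (𝒜 ℬ : Set (PeriodicMergeTree d)) : ℝ≥0∞ :=
  sInf {r | ∃ (k : ℕ) (M M' : Fin (k + 1) → PeriodicMergeTree d),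
    M 0 ∈ 𝒜 ∧ M' (Fin.last k) ∈ ℬ ∧
    (∀ i : Fin k, Equivalent (M' i.castSucc) (M i.succ)) ∧
    r = ∑ i, interleavingDist (M i).1 (M' i).1}

end PeriodicMerge

end

/-! The lattice `Λ₀ = Λ' ⊓ Λ''` has finite index in both `Λ'` and `Λ''`, so it suffices to see that
`M(f, Λ₀)` splinters `M(f, Λ)` whenever `Λ₀` has finite index in `Λ`. The covering of tori
`ℝ^d/Λ₀ → ℝ^d/Λ` induces a map of merge trees, and `Λ` acts on `M(f, Λ₀)` by translations. Since the
components of `(K/Λ)_t` are the images of the components of `K_t`, the fibers of this map are the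
orbits of `Λ`. The stabilizer of a point over `Γ` is `Λ₀ + Λ_Γ`, so the fiber over `Γ` has
`n = [Λ : Λ₀ + Λ_Γ]` points. The periodicity lattice of any of them is `Λ₀ ∩ Λ_Γ`, and from
`[Λ : Λ₀] = [Λ_Γ : Λ₀ ∩ Λ_Γ] n` the ratio of volumes in the frequency is divided by exactly `n`. -/

namespace PeriodicMerge

/-! ### Lattices of finite index -/

theorem inf_toAddSubgroup {E : Type*} [AddCommGroup E] (L P : Submodule ℤ E) :
    (L ⊓ P).toAddSubgroup = L.toAddSubgroup ⊓ P.toAddSubgroup := rfl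

theorem relIndex_mul_relIndex_sup {E : Type*} [AddCommGroup E] {L P M : Submodule ℤ E}
    (hL : L ≤ M) (hP : P ≤ M) :
    L.toAddSubgroup.relIndex P.toAddSubgroup * (L ⊔ P).toAddSubgroup.relIndex M.toAddSubgroup =
      L.toAddSubgroup.relIndex M.toAddSubgroup := by
  have hsup : L.toAddSubgroup ⊔ P.toAddSubgroup ≤ M.toAddSubgroup :=
    sup_le ((Submodule.toAddSubgroup_le _ _).2 hL) ((Submodule.toAddSubgroup_le _ _).2 hP)
  rw [Submodule.sup_toAddSubgroup, ← AddSubgroup.relIndex_mul_relIndex _ _ _ le_sup_left hsup,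
    AddSubgroup.relIndex_sup_left]

theorem discreteTopology_of_le {E : Type*} [AddCommGroup E] [TopologicalSpace E]
    {L₁ L₂ : Submodule ℤ E} (h : L₁ ≤ L₂) [DiscreteTopology L₂] : DiscreteTopology L₁ :=
  DiscreteTopology.of_subset (s := (L₂ : Set E)) ‹_› h

theorem span_eq_of_relIndex_ne_zero {E : Type*} [AddCommGroup E] [Module ℝ E]
    {L₁ L₂ : Submodule ℤ E} (h : L₁ ≤ L₂)
    (hi : L₁.toAddSubgroup.relIndex L₂.toAddSubgroup ≠ 0) :
    Submodule.span ℝ (L₁ : Set E) = Submodule.span ℝ (L₂ : Set E) := by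
  refine le_antisymm (Submodule.span_mono h) (Submodule.span_le.2 fun x hx => ?_)
  obtain ⟨n, hn, -, hnx⟩ := AddSubgroup.exists_nsmul_mem_of_relIndex_ne_zero hi
    (show x ∈ L₂.toAddSubgroup from hx)
  have hnx' : (n : ℝ) • x ∈ Submodule.span ℝ (L₁ : Set E) := by
    rw [Nat.cast_smul_eq_nsmul]
    exact Submodule.subset_span hnx.1
  exact (Submodule.smul_mem_iff _ (Nat.cast_ne_zero.2 hn.ne')).1 hnx'

section Lattice

variable {E : Type*} [NormedAddCommGroup E] [NormedSpace ℝ E] {L₁ L₂ : Submodule ℤ E}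

theorem isZLattice_comap_subtype {L : Submodule ℤ E} {V : Submodule ℝ E}
    (hV : Submodule.span ℝ (L : Set E) = V) [DiscreteTopology (ZLattice.comap ℝ L V.subtype)] :
    IsZLattice ℝ (ZLattice.comap ℝ L V.subtype) := by
  subst hV
  exact ⟨Submodule.span_span_coe_preimage⟩

theorem relIndex_comap_subtype {V : Submodule ℝ E} (hV : (L₂ : Set E) ⊆ V) :
    (ZLattice.comap ℝ L₁ V.subtype).toAddSubgroup.relIndex
        (ZLattice.comap ℝ L₂ V.subtype).toAddSubgroup =
      L₁.toAddSubgroup.relIndex L₂.toAddSubgroup := by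
  rw [ZLattice.comap_toAddSubgroup, ZLattice.comap_toAddSubgroup, AddSubgroup.relIndex_comap,
    AddSubgroup.map_comap_eq_self fun x hx => ⟨⟨x, hV hx⟩, rfl⟩]

variable [FiniteDimensional ℝ E]

theorem finrank_eq_of_relIndex_ne_zero [DiscreteTopology L₂] (h : L₁ ≤ L₂)
    (hi : L₁.toAddSubgroup.relIndex L₂.toAddSubgroup ≠ 0) :
    Module.finrank ℤ L₁ = Module.finrank ℤ L₂ := by
  have : L₁.toAddSubgroup.IsFiniteRelIndex L₂.toAddSubgroup := ⟨hi⟩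
  have : Module.Finite ℤ L₂.toAddSubgroup := inferInstanceAs (Module.Finite ℤ L₂)
  have : Module.IsTorsionFree ℤ L₂.toAddSubgroup := inferInstanceAs (Module.IsTorsionFree ℤ L₂)
  exact AddSubgroup.finrank_eq_of_isFiniteRelIndex (B := L₂.toAddSubgroup)
    (show L₁.toAddSubgroup ≤ L₂.toAddSubgroup from h)

theorem relIndex_ne_zero_of_isZLattice [DiscreteTopology L₁] [IsZLattice ℝ L₁]
    [DiscreteTopology L₂] [IsZLattice ℝ L₂] (h : L₁ ≤ L₂) :
    L₁.toAddSubgroup.relIndex L₂.toAddSubgroup ≠ 0 := by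
  have hrank : Module.finrank ℤ (L₁.submoduleOf L₂) = Module.finrank ℤ L₂ := by
    rw [(Submodule.submoduleOfEquivOfLe h).finrank_eq, ZLattice.rank ℝ L₁, ZLattice.rank ℝ L₂]
  have : Finite (L₂ ⧸ L₁.submoduleOf L₂) := Submodule.finiteQuotientOfFreeOfRankEq _ hrank
  exact (Nat.card_pos (α := L₂ ⧸ L₁.submoduleOf L₂)).ne'

theorem isZLattice_inf {L : Submodule ℤ E} [DiscreteTopology L] [DiscreteTopology L₁]
    [IsZLattice ℝ L₁] [DiscreteTopology L₂] [IsZLattice ℝ L₂]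
    [DiscreteTopology (L₁ ⊓ L₂ : Submodule ℤ E)] (h₁ : L₁ ≤ L) (h₂ : L₂ ≤ L) :
    IsZLattice ℝ (L₁ ⊓ L₂) := by
  have hL : Submodule.span ℝ (L : Set E) = ⊤ :=
    top_unique ((IsZLattice.span_top (K := ℝ) (L := L₁)).ge.trans (Submodule.span_mono h₁))
  have : IsZLattice ℝ L := ⟨hL⟩
  have hi : (L₁ ⊓ L₂).toAddSubgroup.relIndex L.toAddSubgroup ≠ 0 := by
    rw [inf_toAddSubgroup]
    exact AddSubgroup.relIndex_inf_ne_zero (relIndex_ne_zero_of_isZLattice h₁)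
      (relIndex_ne_zero_of_isZLattice h₂)
  exact ⟨(span_eq_of_relIndex_ne_zero (inf_le_left.trans h₁) hi).trans hL⟩

end Lattice

section Frequency

variable {d : ℕ} {L₁ L₂ L P M : Submodule ℤ (EuclideanSpace ℝ (Fin d))}

theorem latticeVolume_eq_covolume_comap {V : Submodule ℝ (EuclideanSpace ℝ (Fin d))}
    (hV : Submodule.span ℝ (L : Set (EuclideanSpace ℝ (Fin d))) = V) :
    latticeVolume L = ZLattice.covolume (ZLattice.comap ℝ L V.subtype) := by
  subst hV
  rw [latticeVolume, OrthonormalBasis.addHaar_eq_volume]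
  rfl

theorem latticeVolume_eq_relIndex_mul [DiscreteTopology L₂] (h : L₁ ≤ L₂)
    (hi : L₁.toAddSubgroup.relIndex L₂.toAddSubgroup ≠ 0) :
    latticeVolume L₁ = L₁.toAddSubgroup.relIndex L₂.toAddSubgroup * latticeVolume L₂ := by
  set V := Submodule.span ℝ (L₂ : Set (EuclideanSpace ℝ (Fin d))) with hV₂
  have hV₁ : Submodule.span ℝ (L₁ : Set (EuclideanSpace ℝ (Fin d))) = V :=
    span_eq_of_relIndex_ne_zero h hi
  have := discreteTopology_of_le h
  have hdiscrete (L : Submodule ℤ (EuclideanSpace ℝ (Fin d))) [DiscreteTopology L] :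
      DiscreteTopology (ZLattice.comap ℝ L V.subtype) :=
    ZLattice.comap_discreteTopology ℝ L continuous_subtype_val Subtype.val_injective
  have := hdiscrete L₁
  have := hdiscrete L₂
  have := isZLattice_comap_subtype hV₁
  have := isZLattice_comap_subtype hV₂.symm
  rw [latticeVolume_eq_covolume_comap hV₁, latticeVolume_eq_covolume_comap hV₂.symm,
    ← relIndex_comap_subtype (V := V) Submodule.subset_span,
    ← ZLattice.covolume_div_covolume_eq_relIndex' (ZLattice.comap ℝ L₁ V.subtype)
      (ZLattice.comap ℝ L₂ V.subtype) (Submodule.comap_mono h),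
    div_mul_cancel₀ _ (ZLattice.covolume_ne_zero _ _)]

theorem latticeVolume_inf_div_latticeVolume [DiscreteTopology M] (hL : L ≤ M) (hP : P ≤ M)
    (hi : L.toAddSubgroup.relIndex M.toAddSubgroup ≠ 0) :
    latticeVolume (L ⊓ P) / latticeVolume L =
      latticeVolume P / latticeVolume M / (L ⊔ P).toAddSubgroup.relIndex M.toAddSubgroup := by
  have hmul := relIndex_mul_relIndex_sup hL hP
  have hinf : (L ⊓ P).toAddSubgroup.relIndex P.toAddSubgroup =
      L.toAddSubgroup.relIndex P.toAddSubgroup := by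
    rw [inf_toAddSubgroup, AddSubgroup.inf_relIndex_right]
  have hiP : L.toAddSubgroup.relIndex P.toAddSubgroup ≠ 0 := left_ne_zero_of_mul (hmul.trans_ne hi)
  have := discreteTopology_of_le hP
  rw [latticeVolume_eq_relIndex_mul inf_le_right (hinf.trans_ne hiP),
    latticeVolume_eq_relIndex_mul hL hi, hinf, ← hmul, Nat.cast_mul, mul_assoc,
    mul_div_mul_left _ _ (Nat.cast_ne_zero.2 hiP), div_div, mul_comm (latticeVolume M)]

theorem periodicityLattice_le (L : Submodule ℤ (EuclideanSpace ℝ (Fin d)))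
    (C : Set (EuclideanSpace ℝ (Fin d) ⧸ L)) : periodicityLattice L C ≤ L :=
  fun _ h => h.1

theorem shadowMonomial_eq_divNat [DiscreteTopology M] (hL : L ≤ M)
    (hi : L.toAddSubgroup.relIndex M.toAddSubgroup ≠ 0)
    {C₀ : Set (EuclideanSpace ℝ (Fin d) ⧸ L)} {C : Set (EuclideanSpace ℝ (Fin d) ⧸ M)}
    (hC : periodicityLattice L C₀ = L ⊓ periodicityLattice M C) :
    shadowMonomial L C₀ = (shadowMonomial M C).divNat
      ((L ⊔ periodicityLattice M C).toAddSubgroup.relIndex M.toAddSubgroup) := by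
  have hP := periodicityLattice_le M C
  have := discreteTopology_of_le hP
  have hiP : (L ⊓ periodicityLattice M C).toAddSubgroup.relIndex
      (periodicityLattice M C).toAddSubgroup ≠ 0 := by
    rw [inf_toAddSubgroup, AddSubgroup.inf_relIndex_right]
    exact left_ne_zero_of_mul ((relIndex_mul_relIndex_sup hL hP).trans_ne hi)
  unfold shadowMonomial Monomial.divNat
  rw [hC, finrank_eq_of_relIndex_ne_zero inf_le_right hiP,
    latticeVolume_inf_div_latticeVolume hL hP hi, div_mul_eq_mul_div]

end Frequency

/-! ### Isomorphisms and splinterings of decorated trees -/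

section DecoratedTree

variable {T T' : DecoratedTree}

theorem Monomial.le_refl (m : Monomial) : m ≤ m := Or.inr ⟨rfl, le_rfl⟩

/-- An isomorphism of decorated trees: a homeomorphism that preserves the height, the covering
relation and the frequency. Isomorphic trees have interleaving distance `0`. -/
structure DecoratedTree.Iso (T T' : DecoratedTree) extends T.Pt ≃ₜ T'.Pt where
  height_apply : ∀ A, T'.height (toFun A) = T.height A
  covers_iff : ∀ A B, T'.Covers (toFun B) (toFun A) ↔ T.Covers B A
  freq_apply : ∀ A, T'.freq (toFun A) = T.freq A

namespace DecoratedTree.Iso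

/-- The identity, as an isomorphism of decorated trees. -/
def refl (T : DecoratedTree) : T.Iso T where
  toHomeomorph := Homeomorph.refl T.Pt
  height_apply _ := rfl
  covers_iff _ _ := Iff.rfl
  freq_apply _ := rfl

/-- The restriction of an isomorphism to the subtrees below a point and its image. -/
def subtree (e : T.Iso T') (A : T.Pt) : (T.subtree A).Iso (T'.subtree (e.toFun A)) where
  toHomeomorph := e.toHomeomorph.subtype fun B => (e.covers_iff B A).symm
  height_apply B := e.height_apply B.1
  covers_iff B C := e.covers_iff B.1 C.1
  freq_apply B := e.freq_apply B.1

theorem isCompatible (e : T.Iso T') (hT : ∀ A, T.Covers A A) :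
    IsCompatible T T' 0 e.toFun e.invFun where
  continuous_left := e.continuous_toFun
  continuous_right := e.continuous_invFun
  height_left A := (e.height_apply A).trans (add_zero _).symm
  height_right A := by
    rw [← e.height_apply, e.right_inv A]
    exact (add_zero _).symm
  covers_left A := by simpa only [e.left_inv A] using hT A
  covers_right A := by simpa only [e.right_inv A] using (e.covers_iff _ _).2 (hT (e.invFun A))
  freq_left A := e.freq_apply A ▸ Monomial.le_refl _
  freq_right A := by
    rw [← e.freq_apply, e.right_inv A]
    exact Monomial.le_refl _

theorem interleavingDist_eq_zero (e : T.Iso T') (hT : ∀ A, T.Covers A A) :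
    interleavingDist T T' = 0 :=
  le_antisymm (iInf₂_le_of_le 0 ⟨_, _, e.isCompatible hT⟩ ENNReal.coe_zero.le) bot_le

end DecoratedTree.Iso

theorem splinters_of_transitive {ω : T'.Pt → T.Pt} (hcont : Continuous ω)
    (hsurj : Function.Surjective ω) (hheight : ∀ A, T.height (ω A) = T'.height A)
    (hrefl : ∀ A, T'.Covers A A) (hfin : ∀ A, (ω ⁻¹' {ω A}).Finite)
    (htrans : ∀ A B, ω A = ω B → ∃ e : T'.Iso T', e.toFun A = B)
    (hcovers : ∀ A, ω '' {X | T'.Covers A X} = {Y | T.Covers (ω A) Y})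
    (hfreq : ∀ A, T'.freq A = (T.freq (ω A)).divNat (ω ⁻¹' {ω A}).ncard) : Splinters T' T := by
  refine ⟨ω, hcont, hsurj, hheight, fun C => ?_⟩
  obtain ⟨A₀, rfl⟩ := hsurj C
  refine ⟨hfin A₀, fun A (hA : ω A = ω A₀) B (hB : ω B = ω A₀) => ?_⟩
  obtain ⟨e, rfl⟩ := htrans A B (hA.trans hB.symm)
  rw [← e.freq_apply A, ← hB, ← hcovers]
  refine ⟨(e.subtree A).interleavingDist_eq_zero fun X => hrefl X.1, ?_, rfl, rfl, hfreq _⟩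
  rw [hcovers, hcovers, hA, hB]

theorem Splinters.refl (hT : ∀ A, T.Covers A A) : Splinters T T :=
  splinters_of_transitive (ω := id) continuous_id Function.surjective_id (fun _ => rfl) hT
    (fun _ => Set.finite_singleton _) (fun _ _ h => ⟨.refl T, h⟩) (fun _ => Set.image_id _)
    (fun A => by simp [Monomial.divNat])

end DecoratedTree

/-! ### Merge trees -/

theorem mapsTo_connectedComponentIn {X Y : Type*} [TopologicalSpace X] [TopologicalSpace Y]
    {g : X → Y} (hg : Continuous g) {A : Set X} {B : Set Y} (h : Set.MapsTo g A B) (x : X) :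
    Set.MapsTo g (connectedComponentIn A x) (connectedComponentIn B (g x)) := fun y hy =>
  connectedComponentIn_mono _ h.image_subset
    (hg.continuousOn.mapsTo_connectedComponentIn (connectedComponentIn_nonempty_iff.1 ⟨y, hy⟩) hy)

namespace MergeTree

variable {X Y : Type} [TopologicalSpace X] [TopologicalSpace Y] {S : ℝ → Set X} {S' : ℝ → Set Y}
  {s t : ℝ} {x y : X}

/-- The point of the merge tree at height `t` represented by a point of the sublevel set `S t`. -/
def mk (hx : x ∈ S t) : MergeTree S := Quotient.mk (mergeSetoid S) ⟨(x, t), hx⟩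

theorem exists_mk_eq (A : MergeTree S) : ∃ (t : ℝ) (x : X) (hx : x ∈ S t), mk hx = A := by
  induction A using Quotient.ind with | _ q
  exact ⟨q.1.2, q.1.1, q.2, rfl⟩

theorem component_mk (hx : x ∈ S t) : (mk hx).component = connectedComponentIn (S t) x := rfl

theorem covers_refl (A : MergeTree S) : A.Covers A := ⟨le_rfl, subset_rfl⟩

theorem mk_eq_mk_iff (hx : x ∈ S t) (hy : y ∈ S t) :
    mk hx = mk hy ↔ y ∈ connectedComponentIn (S t) x := by
  constructor
  · intro h
    rw [← component_mk hx, h]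
    exact mem_connectedComponentIn hy
  · exact fun h => Quotient.sound (s := mergeSetoid S) ⟨rfl, connectedComponentIn_eq h⟩

theorem covers_mk_iff (hS : Monotone S) (hx : x ∈ S t) (hy : y ∈ S s) :
    (mk hx).Covers (mk hy) ↔ s ≤ t ∧ y ∈ connectedComponentIn (S t) x := by
  refine and_congr_right fun hst => ⟨fun h => h (mem_connectedComponentIn hy), fun h => ?_⟩
  rw [component_mk, component_mk, connectedComponentIn_eq h]
  exact connectedComponentIn_mono _ (hS hst)

variable {g : X → Y} (hg : Continuous g) (h : ∀ t, Set.MapsTo g (S t) (S' t))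

/-- The map of merge trees induced by a continuous map that respects the sublevel sets. -/
def map (g : X → Y) (hg : Continuous g) (h : ∀ t, Set.MapsTo g (S t) (S' t)) :
    MergeTree S → MergeTree S' :=
  Quotient.lift (fun q : SublevelSpace S => mk (h q.1.2 q.2)) (by
    rintro ⟨⟨x, s⟩, hx⟩ ⟨⟨y, t⟩, hy⟩ hxy
    obtain rfl : s = t := hxy.1
    have hyx := (mk_eq_mk_iff hx hy).1 (Quotient.sound hxy)
    exact (mk_eq_mk_iff _ _).2 (mapsTo_connectedComponentIn hg (h s) x hyx))

theorem continuous_map : Continuous (map g hg h) := by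
  have hcont : Continuous fun q : SublevelSpace S => (g q.1.1, q.1.2) :=
    (hg.comp (continuous_fst.comp continuous_subtype_val)).prodMk
      (continuous_snd.comp continuous_subtype_val)
  exact (continuous_coinduced_rng.comp (hcont.subtype_mk fun q => h q.1.2 q.2)).quotient_lift _

theorem height_map (A : MergeTree S) : (map g hg h A).height = A.height := by
  obtain ⟨t, x, hx, rfl⟩ := exists_mk_eq A
  rfl

theorem Covers.map (hS : Monotone S) (hS' : Monotone S') {A B : MergeTree S} (hBA : B.Covers A) :
    (map g hg h B).Covers (map g hg h A) := by
  obtain ⟨s, x, hx, rfl⟩ := exists_mk_eq A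
  obtain ⟨t, y, hy, rfl⟩ := exists_mk_eq B
  obtain ⟨hst, hxy⟩ := (covers_mk_iff hS hy hx).1 hBA
  exact (covers_mk_iff hS' _ _).2 ⟨hst, mapsTo_connectedComponentIn hg (h t) y hxy⟩

end MergeTree

theorem Equivalent.refl {d : ℕ} (M : PeriodicMergeTree d) : Equivalent M M := by
  obtain ⟨K, f, Λ, _, -, -, hM⟩ := M.2
  have hsplinters : Splinters M.1 M.1 := hM ▸ Splinters.refl MergeTree.covers_refl
  exact ⟨M, hsplinters, hsplinters⟩

theorem interleavingPseudoDist_equivClass_eq_zero {d : ℕ} {M N : PeriodicMergeTree d}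
    (h : Equivalent M N) : interleavingPseudoDist (equivClass M) (equivClass N) = 0 := by
  have hself : interleavingDist M.1 M.1 = 0 := by
    obtain ⟨K, f, Λ, _, -, -, hM⟩ := M.2
    exact hM ▸ (DecoratedTree.Iso.refl _).interleavingDist_eq_zero MergeTree.covers_refl
  refine le_antisymm (sInf_le ⟨0, fun _ => M, fun _ => M, .refl M, h, fun i => i.elim0, ?_⟩) bot_le
  rw [Fin.sum_univ_one, hself]

/-! ### Components of periodic sublevel sets -/

section Quotient

variable {R M : Type*} [Ring R] [AddCommGroup M] [Module R M] {p : Submodule R M} {c : Set M}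
  {u y : M}

theorem mkQ_mem_image_mkQ_iff : p.mkQ y ∈ p.mkQ '' c ↔ ∃ u ∈ p, u + y ∈ c := by
  constructor
  · rintro ⟨z, hz, hzy⟩
    exact ⟨z - y, (Submodule.Quotient.eq p).1 hzy, by rwa [sub_add_cancel]⟩
  · rintro ⟨u, hu, huy⟩
    exact ⟨u + y, huy, (Submodule.Quotient.eq p).2 (by rwa [add_sub_cancel_right])⟩

theorem image_mkQ_vadd (hu : u ∈ p) : p.mkQ '' (u +ᵥ c) = p.mkQ '' c := by
  rw [← Set.image_vadd, Set.image_image]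
  exact Set.image_congr fun z _ => (Submodule.Quotient.eq p).2 (by simpa using hu)

end Quotient

variable {d : ℕ} {K : CellComplex d} {f : K.cells → ℝ}
  {Λ Λ₀ : Submodule ℤ (EuclideanSpace ℝ (Fin d))} {s t : ℝ} {u x y : EuclideanSpace ℝ (Fin d)}

namespace CellComplex

theorem isClosed_cell (σ : K.cells) : IsClosed σ.1 := by
  obtain ⟨h, -⟩ := K.exists_homeomorph σ
  have : CompactSpace σ.1 := h.compactSpace
  exact (isCompact_iff_compactSpace.2 this).isClosed

theorem isPreconnected_cell (σ : K.cells) : IsPreconnected σ.1 := by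
  obtain ⟨h, -⟩ := K.exists_homeomorph σ
  have : PreconnectedSpace (Metric.closedBall (0 : EuclideanSpace ℝ (Fin (K.dim σ))) 1) :=
    isPreconnected_iff_preconnectedSpace.1 (convex_closedBall _ _).isPreconnected
  have hrange := isPreconnected_range (continuous_subtype_val.comp h.continuous)
  rwa [h.surjective.range_comp, Subtype.range_coe] at hrange

theorem mem_sublevel_iff : x ∈ K.sublevel f t ↔ ∃ σ : K.cells, f σ ≤ t ∧ x ∈ σ.1 := by
  simp only [sublevel, Set.mem_iUnion, Set.mem_ofPred_eq, exists_prop]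

theorem monotone_sublevel : Monotone (K.sublevel f) := fun _ _ hst =>
  Set.biUnion_subset_biUnion_left fun _ hσ => le_trans hσ hst

theorem monotone_quotientSublevel : Monotone (K.quotientSublevel f Λ) := fun _ _ hst =>
  Set.image_mono (monotone_sublevel hst)

theorem mkQ_mem_quotientSublevel (hx : x ∈ K.sublevel f t) :
    Λ.mkQ x ∈ K.quotientSublevel f Λ t :=
  Set.mem_image_of_mem _ hx

theorem isClosed_of_cell_subset {U : Set (EuclideanSpace ℝ (Fin d))} (hU : U ⊆ K.sublevel f t)
    (hcell : ∀ σ : K.cells, f σ ≤ t → (σ.1 ∩ U).Nonempty → σ.1 ⊆ U) : IsClosed U := by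
  have hU' : U = ⋃ σ : {σ : K.cells // σ.1 ⊆ U}, σ.1.1 := by
    refine Set.Subset.antisymm (fun x hx => ?_) (Set.iUnion_subset fun σ => σ.2)
    obtain ⟨σ, hσ, hxσ⟩ := mem_sublevel_iff.1 (hU hx)
    exact Set.mem_iUnion.2 ⟨⟨σ, hcell σ hσ ⟨x, hxσ, hx⟩⟩, hxσ⟩
  rw [hU']
  exact (K.locallyFinite.comp_injective Subtype.val_injective).isClosed_iUnion
    fun σ => isClosed_cell σ.1

/-- The connected component of `x` in the sublevel set `K_t`; it is empty if `x ∉ K_t`. -/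
def component (K : CellComplex d) (f : K.cells → ℝ) (t : ℝ) (x : EuclideanSpace ℝ (Fin d)) :
    Set (EuclideanSpace ℝ (Fin d)) :=
  connectedComponentIn (K.sublevel f t) x

theorem component_subset : K.component f t x ⊆ K.sublevel f t :=
  connectedComponentIn_subset _ _

theorem mem_component (hx : x ∈ K.sublevel f t) : x ∈ K.component f t x :=
  mem_connectedComponentIn hx

theorem component_eq (hy : y ∈ K.component f t x) : K.component f t x = K.component f t y :=
  connectedComponentIn_eq hy

theorem cell_subset_component {σ : K.cells} (hσ : f σ ≤ t) (hx : x ∈ σ.1) :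
    σ.1 ⊆ K.component f t x :=
  (isPreconnected_cell σ).subset_connectedComponentIn hx
    fun _ hz => mem_sublevel_iff.2 ⟨σ, hσ, hz⟩

namespace IsPeriodicFilter

variable (hf : K.IsPeriodicFilter f Λ)
include hf

theorem add_mem_sublevel (hu : u ∈ Λ) (hx : x ∈ K.sublevel f t) : u + x ∈ K.sublevel f t := by
  obtain ⟨σ, hσ, hxσ⟩ := mem_sublevel_iff.1 hx
  refine mem_sublevel_iff.2
    ⟨⟨u +ᵥ σ.1, hf.isPeriodic _ σ.2 u hu⟩, ?_, Set.vadd_mem_vadd_set hxσ⟩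
  rwa [hf.isPeriodicFun σ _ u hu rfl]

theorem add_mem_sublevel_iff (hu : u ∈ Λ) : u + x ∈ K.sublevel f t ↔ x ∈ K.sublevel f t :=
  ⟨fun h => by simpa using hf.add_mem_sublevel (Λ.neg_mem hu) h, hf.add_mem_sublevel hu⟩

theorem vadd_sublevel (hu : u ∈ Λ) : u +ᵥ K.sublevel f t = K.sublevel f t := by
  ext x
  rw [Set.mem_vadd_set_iff_neg_vadd_mem, vadd_eq_add, hf.add_mem_sublevel_iff (Λ.neg_mem hu)]

theorem vadd_component (hu : u ∈ Λ) (hx : x ∈ K.sublevel f t) :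
    u +ᵥ K.component f t x = K.component f t (u + x) := by
  have himage : Homeomorph.addLeft u '' K.sublevel f t = K.sublevel f t := hf.vadd_sublevel hu
  have h := (Homeomorph.addLeft u).image_connectedComponentIn hx
  rwa [himage] at h

theorem preimage_quotientSublevel : Λ.mkQ ⁻¹' K.quotientSublevel f Λ t = K.sublevel f t := by
  ext x
  rw [Set.mem_preimage, quotientSublevel, mkQ_mem_image_mkQ_iff]
  exact ⟨fun ⟨_, hu, hx⟩ => (hf.add_mem_sublevel_iff hu).1 hx,
    fun hx => ⟨0, Λ.zero_mem, by rwa [zero_add]⟩⟩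

theorem image_component_eq (hy : Λ.mkQ y ∈ Λ.mkQ '' K.component f t x) :
    Λ.mkQ '' K.component f t x = Λ.mkQ '' K.component f t y := by
  obtain ⟨u, hu, huy⟩ := mkQ_mem_image_mkQ_iff.1 hy
  rw [component_eq huy, ← hf.vadd_component hu ((hf.add_mem_sublevel_iff hu).1
    (component_subset huy)), image_mkQ_vadd hu]

theorem cell_subset_preimage_image_component {σ : K.cells} (hσ : f σ ≤ t)
    (hne : (σ.1 ∩ Λ.mkQ ⁻¹' (Λ.mkQ '' K.component f t x)).Nonempty) :
    σ.1 ⊆ Λ.mkQ ⁻¹' (Λ.mkQ '' K.component f t x) := by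
  obtain ⟨y, hyσ, hy⟩ := hne
  rw [hf.image_component_eq hy]
  exact (cell_subset_component hσ hyσ).trans (Set.subset_preimage_image _ _)

theorem preimage_image_component_subset :
    Λ.mkQ ⁻¹' (Λ.mkQ '' K.component f t x) ⊆ K.sublevel f t := by
  rw [← hf.preimage_quotientSublevel]
  exact Set.preimage_mono (Set.image_mono component_subset)

theorem isClosed_image_component : IsClosed (Λ.mkQ '' K.component f t x) := by
  rw [← Λ.isQuotientMap_mkQ.isClosed_preimage]
  exact isClosed_of_cell_subset hf.preimage_image_component_subset
    fun _ hσ => hf.cell_subset_preimage_image_component hσ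

theorem isClosed_quotientSublevel_sdiff_image_component :
    IsClosed (K.quotientSublevel f Λ t \ Λ.mkQ '' K.component f t x) := by
  rw [← Λ.isQuotientMap_mkQ.isClosed_preimage, Set.preimage_sdiff, hf.preimage_quotientSublevel]
  refine isClosed_of_cell_subset Set.sdiff_subset ?_
  rintro σ hσ ⟨y, hyσ, -, hy⟩ z hz
  exact ⟨mem_sublevel_iff.2 ⟨σ, hσ, hz⟩,
    fun hz' => hy (hf.cell_subset_preimage_image_component hσ ⟨z, hz, hz'⟩ hyσ)⟩

theorem connectedComponentIn_quotientSublevel (hx : x ∈ K.sublevel f t) :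
    connectedComponentIn (K.quotientSublevel f Λ t) (Λ.mkQ x) = Λ.mkQ '' K.component f t x := by
  refine Set.Subset.antisymm ?_
    (Λ.continuous_mkQ.continuousOn.image_connectedComponentIn_subset hx)
  have hcases := isPreconnected_iff_subset_of_disjoint_closed.1
    (isPreconnected_connectedComponentIn (F := K.quotientSublevel f Λ t) (x := Λ.mkQ x)) _ _
    hf.isClosed_image_component
    (hf.isClosed_quotientSublevel_sdiff_image_component (t := t) (x := x))
    (by rw [Set.union_sdiff_self]
        exact (connectedComponentIn_subset _ _).trans Set.subset_union_right)
    (by rw [Set.inter_sdiff_self, Set.inter_empty])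
  exact hcases.resolve_right fun h => (h (mem_connectedComponentIn (Set.mem_image_of_mem _ hx))).2
    (Set.mem_image_of_mem _ (mem_component hx))

theorem connectedComponentIn_preimage_image_component
    (hy : Λ.mkQ y ∈ Λ.mkQ '' K.component f t x) :
    connectedComponentIn (Λ.mkQ ⁻¹' (Λ.mkQ '' K.component f t x)) y = K.component f t y := by
  refine Set.Subset.antisymm (connectedComponentIn_mono _ hf.preimage_image_component_subset) ?_
  refine isPreconnected_connectedComponentIn.subset_connectedComponentIn
    (mem_component (hf.preimage_image_component_subset hy)) ?_
  rw [hf.image_component_eq hy]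
  exact Set.subset_preimage_image _ _

theorem mem_periodicityLattice_iff (hx : x ∈ K.sublevel f t) :
    u ∈ periodicityLattice Λ (Λ.mkQ '' K.component f t x) ↔
      u ∈ Λ ∧ u + x ∈ K.component f t x := by
  change (u ∈ Λ ∧ ∀ c, IsShadow Λ (Λ.mkQ '' K.component f t x) c → u +ᵥ c = c) ↔ _
  refine and_congr_right fun hu => ⟨fun h => ?_, ?_⟩
  · have hxC := Set.mem_image_of_mem Λ.mkQ (mem_component hx)
    have hxx := h _ ⟨x, hxC, (hf.connectedComponentIn_preimage_image_component hxC).symm⟩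
    exact hxx ▸ Set.vadd_mem_vadd_set (mem_component hx)
  · rintro hux _ ⟨y, hy, rfl⟩
    rw [hf.connectedComponentIn_preimage_image_component hy]
    have hyt := hf.preimage_image_component_subset hy
    obtain ⟨v, hv, hvy⟩ := mkQ_mem_image_mkQ_iff.1 hy
    apply vadd_left_cancel v
    rw [vadd_comm, hf.vadd_component hv hyt, ← component_eq hvy, hf.vadd_component hu hx,
      ← component_eq hux]

theorem periodicityLattice_eq_inf (hle : Λ₀ ≤ Λ) (hx : x ∈ K.sublevel f t) :
    periodicityLattice Λ₀ (Λ₀.mkQ '' K.component f t x) =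
      Λ₀ ⊓ periodicityLattice Λ (Λ.mkQ '' K.component f t x) := by
  ext v
  rw [(hf.mono hle).mem_periodicityLattice_iff hx, Submodule.mem_inf,
    hf.mem_periodicityLattice_iff hx]
  exact and_congr_right fun hv => (and_iff_right (hle hv)).symm

theorem periodicityLattice_add (hle : Λ₀ ≤ Λ) (hu : u ∈ Λ) (hx : x ∈ K.sublevel f t) :
    periodicityLattice Λ₀ (Λ₀.mkQ '' K.component f t (u + x)) =
      periodicityLattice Λ₀ (Λ₀.mkQ '' K.component f t x) := by
  ext v
  rw [(hf.mono hle).mem_periodicityLattice_iff (hf.add_mem_sublevel hu hx),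
    (hf.mono hle).mem_periodicityLattice_iff hx, add_left_comm v u x,
    ← hf.vadd_component hu hx]
  exact and_congr_right fun _ => Set.vadd_mem_vadd_set_iff

end IsPeriodicFilter

end CellComplex

/-! ### Merge trees of a periodic filter with respect to a sublattice -/

open CellComplex (component mem_component monotone_quotientSublevel)

variable (Λ) in
/-- The point of the merge tree of `f/Λ` at height `t` represented by a point of `K_t`. -/
def treePt (hx : x ∈ K.sublevel f t) : MergeTree (K.quotientSublevel f Λ) :=
  MergeTree.mk (CellComplex.mkQ_mem_quotientSublevel hx)

theorem exists_treePt_eq (A : MergeTree (K.quotientSublevel f Λ)) :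
    ∃ (t : ℝ) (x : EuclideanSpace ℝ (Fin d)) (hx : x ∈ K.sublevel f t), treePt Λ hx = A := by
  obtain ⟨t, _, ⟨x, hx, rfl⟩, rfl⟩ := MergeTree.exists_mk_eq A
  exact ⟨t, x, hx, rfl⟩

theorem component_treePt (hf : K.IsPeriodicFilter f Λ) (hx : x ∈ K.sublevel f t) :
    (treePt Λ hx).component = Λ.mkQ '' K.component f t x :=
  hf.connectedComponentIn_quotientSublevel hx

theorem treePt_eq_treePt_iff (hf : K.IsPeriodicFilter f Λ) (hx : x ∈ K.sublevel f t)
    (hy : y ∈ K.sublevel f t) :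
    treePt Λ hx = treePt Λ hy ↔ ∃ u ∈ Λ, u + y ∈ K.component f t x := by
  rw [treePt, treePt, MergeTree.mk_eq_mk_iff, hf.connectedComponentIn_quotientSublevel hx,
    mkQ_mem_image_mkQ_iff]

theorem covers_treePt_iff (hf : K.IsPeriodicFilter f Λ) (hx : x ∈ K.sublevel f t)
    (hy : y ∈ K.sublevel f s) :
    (treePt Λ hx).Covers (treePt Λ hy) ↔ s ≤ t ∧ ∃ u ∈ Λ, u + y ∈ K.component f t x := by
  rw [treePt, treePt, MergeTree.covers_mk_iff monotone_quotientSublevel,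
    hf.connectedComponentIn_quotientSublevel hx, mkQ_mem_image_mkQ_iff]

/-- The map of merge trees induced by `ℝ^d/Λ₀ → ℝ^d/Λ` for a sublattice `Λ₀` of `Λ`. -/
def projTree (K : CellComplex d) (f : K.cells → ℝ) (hle : Λ₀ ≤ Λ) :
    MergeTree (K.quotientSublevel f Λ₀) → MergeTree (K.quotientSublevel f Λ) :=
  MergeTree.map (Λ₀.mapQ Λ LinearMap.id hle)
    (Λ₀.isQuotientMap_mkQ.continuous_iff.2 Λ.continuous_mkQ) (by
      rintro t _ ⟨x, hx, rfl⟩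
      exact ⟨x, hx, rfl⟩)

theorem continuous_projTree (hle : Λ₀ ≤ Λ) : Continuous (projTree K f hle) :=
  MergeTree.continuous_map _ _

theorem projTree_treePt (hle : Λ₀ ≤ Λ) (hx : x ∈ K.sublevel f t) :
    projTree K f hle (treePt Λ₀ hx) = treePt Λ hx :=
  rfl

theorem surjective_projTree (hle : Λ₀ ≤ Λ) : Function.Surjective (projTree K f hle) := fun C => by
  obtain ⟨t, x, hx, rfl⟩ := exists_treePt_eq C
  exact ⟨treePt Λ₀ hx, rfl⟩

namespace CellComplex.IsPeriodicFilter

variable (hf : K.IsPeriodicFilter f Λ)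

/-- The action of `Λ` by translations on the merge tree of `f/Λ₀`. It is not an instance because it
depends on the periodicity of `f`. -/
abbrev translationAction (Λ₀ : Submodule ℤ (EuclideanSpace ℝ (Fin d))) :
    AddAction Λ (MergeTree (K.quotientSublevel f Λ₀)) where
  vadd u := MergeTree.map (Λ₀.mkQ u + ·) (continuous_const_add _) (by
    rintro t _ ⟨x, hx, rfl⟩
    exact ⟨u + x, hf.add_mem_sublevel u.2 hx, map_add _ _ _⟩)
  zero_vadd A := by
    obtain ⟨t, x, hx, rfl⟩ := exists_treePt_eq A
    change treePt Λ₀ (hf.add_mem_sublevel Λ.zero_mem hx) = treePt Λ₀ hx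
    simp only [zero_add]
  add_vadd u v A := by
    obtain ⟨t, x, hx, rfl⟩ := exists_treePt_eq A
    change treePt Λ₀ (hf.add_mem_sublevel (u + v).2 hx) =
      treePt Λ₀ (hf.add_mem_sublevel u.2 (hf.add_mem_sublevel v.2 hx))
    simp only [Submodule.coe_add, add_assoc]

theorem vadd_treePt (u : Λ) (hx : x ∈ K.sublevel f t) :
    letI := hf.translationAction Λ₀
    u +ᵥ treePt Λ₀ hx = treePt Λ₀ (hf.add_mem_sublevel u.2 hx) :=
  rfl

include hf

theorem projTree_vadd (hle : Λ₀ ≤ Λ) (u : Λ) (A : MergeTree (K.quotientSublevel f Λ₀)) :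
    letI := hf.translationAction Λ₀
    projTree K f hle (u +ᵥ A) = projTree K f hle A := by
  obtain ⟨t, x, hx, rfl⟩ := exists_treePt_eq A
  have hux := hf.add_mem_sublevel u.2 hx
  exact (treePt_eq_treePt_iff hf hux hx).2 ⟨u, u.2, mem_component hux⟩

theorem preimage_projTree_eq_orbit (hle : Λ₀ ≤ Λ) (A : MergeTree (K.quotientSublevel f Λ₀)) :
    letI := hf.translationAction Λ₀
    projTree K f hle ⁻¹' {projTree K f hle A} = AddAction.orbit Λ A := by
  ext B
  constructor
  · intro h
    obtain ⟨t, x, hx, rfl⟩ := exists_treePt_eq A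
    obtain ⟨s, y, hy, rfl⟩ := exists_treePt_eq B
    obtain rfl : s = t := congr_arg MergeTree.height h
    obtain ⟨u, hu, huy⟩ := (treePt_eq_treePt_iff hf hy hx).1 h
    exact ⟨⟨u, hu⟩, ((treePt_eq_treePt_iff (hf.mono hle) hy (hf.add_mem_sublevel hu hx)).2
      ⟨0, Λ₀.zero_mem, by rwa [zero_add]⟩).symm⟩
  · rintro ⟨u, rfl⟩
    exact hf.projTree_vadd hle u _

theorem stabilizer_translationAction (hle : Λ₀ ≤ Λ) (A : MergeTree (K.quotientSublevel f Λ₀)) :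
    letI := hf.translationAction Λ₀
    AddAction.stabilizer Λ A = (Λ₀ ⊔ periodicityLattice Λ
      (projTree K f hle A).component).toAddSubgroup.addSubgroupOf Λ.toAddSubgroup := by
  let := hf.translationAction Λ₀
  obtain ⟨t, x, hx, rfl⟩ := exists_treePt_eq A
  rw [projTree_treePt, component_treePt hf]
  ext u
  change treePt Λ₀ (hf.add_mem_sublevel u.2 hx) = treePt Λ₀ hx ↔ u.1 ∈ Λ₀ ⊔ periodicityLattice _ _
  rw [eq_comm, treePt_eq_treePt_iff (hf.mono hle), Submodule.mem_sup]
  constructor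
  · rintro ⟨v, hv, hvx⟩
    refine ⟨-v, Λ₀.neg_mem hv, v + u, (hf.mem_periodicityLattice_iff hx).2
      ⟨Λ.add_mem (hle hv) u.2, by rwa [add_assoc]⟩, neg_add_cancel_left v u.1⟩
  · rintro ⟨v, hv, w, hw, hvw⟩
    refine ⟨-v, Λ₀.neg_mem hv, ?_⟩
    rw [← hvw, add_assoc, neg_add_cancel_left]
    exact ((hf.mem_periodicityLattice_iff hx).1 hw).2

theorem ncard_preimage_projTree (hle : Λ₀ ≤ Λ) (A : MergeTree (K.quotientSublevel f Λ₀)) :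
    (projTree K f hle ⁻¹' {projTree K f hle A}).ncard =
      (Λ₀ ⊔ periodicityLattice Λ (projTree K f hle A).component).toAddSubgroup.relIndex
        Λ.toAddSubgroup := by
  let := hf.translationAction Λ₀
  rw [hf.preimage_projTree_eq_orbit, ← AddAction.index_stabilizer,
    hf.stabilizer_translationAction hle]
  rfl

theorem finite_preimage_projTree (hle : Λ₀ ≤ Λ)
    (hi : Λ₀.toAddSubgroup.relIndex Λ.toAddSubgroup ≠ 0)
    (A : MergeTree (K.quotientSublevel f Λ₀)) :
    (projTree K f hle ⁻¹' {projTree K f hle A}).Finite := by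
  have hmul := relIndex_mul_relIndex_sup hle
    (periodicityLattice_le Λ (projTree K f hle A).component)
  rw [← hf.ncard_preimage_projTree hle A] at hmul
  exact Set.finite_of_ncard_ne_zero (right_ne_zero_of_mul (hmul.trans_ne hi))

theorem shadowMonomial_component_eq_divNat [DiscreteTopology Λ] (hle : Λ₀ ≤ Λ)
    (hi : Λ₀.toAddSubgroup.relIndex Λ.toAddSubgroup ≠ 0)
    (A : MergeTree (K.quotientSublevel f Λ₀)) :
    shadowMonomial Λ₀ A.component = (shadowMonomial Λ (projTree K f hle A).component).divNat
      (projTree K f hle ⁻¹' {projTree K f hle A}).ncard := by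
  rw [hf.ncard_preimage_projTree]
  refine shadowMonomial_eq_divNat hle hi ?_
  obtain ⟨t, x, hx, rfl⟩ := exists_treePt_eq A
  rw [projTree_treePt, component_treePt hf, component_treePt (hf.mono hle),
    hf.periodicityLattice_eq_inf hle hx]

theorem image_projTree_setOf_covers (hle : Λ₀ ≤ Λ) (A : MergeTree (K.quotientSublevel f Λ₀)) :
    projTree K f hle '' {B | A.Covers B} = {C | (projTree K f hle A).Covers C} := by
  refine Set.Subset.antisymm ?_ fun C hC => ?_
  · rintro _ ⟨B, hB, rfl⟩
    exact hB.map _ _ monotone_quotientSublevel monotone_quotientSublevel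
  · obtain ⟨t, x, hx, rfl⟩ := exists_treePt_eq A
    obtain ⟨s, y, hy, rfl⟩ := exists_treePt_eq C
    obtain ⟨hst, u, hu, huy⟩ := (covers_treePt_iff hf hx hy).1 hC
    have hy' := hf.add_mem_sublevel hu hy
    refine ⟨treePt Λ₀ hy', (covers_treePt_iff (hf.mono hle) hx hy').2
      ⟨hst, 0, Λ₀.zero_mem, by rwa [zero_add]⟩, ?_⟩
    exact (treePt_eq_treePt_iff hf hy' hy).2 ⟨u, hu, mem_component hy'⟩

theorem shadowMonomial_component_vadd (hle : Λ₀ ≤ Λ) (u : Λ)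
    (A : MergeTree (K.quotientSublevel f Λ₀)) :
    letI := hf.translationAction Λ₀
    shadowMonomial Λ₀ (u +ᵥ A).component = shadowMonomial Λ₀ A.component := by
  obtain ⟨t, x, hx, rfl⟩ := exists_treePt_eq A
  rw [vadd_treePt, component_treePt (hf.mono hle), component_treePt (hf.mono hle), shadowMonomial,
    shadowMonomial, hf.periodicityLattice_add hle u.2 hx]

theorem height_vadd (u : Λ) (A : MergeTree (K.quotientSublevel f Λ₀)) :
    letI := hf.translationAction Λ₀
    (u +ᵥ A).height = A.height :=
  MergeTree.height_map _ _ A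

theorem covers_vadd_iff (u : Λ) (A B : MergeTree (K.quotientSublevel f Λ₀)) :
    letI := hf.translationAction Λ₀
    (u +ᵥ B).Covers (u +ᵥ A) ↔ B.Covers A := by
  let := hf.translationAction Λ₀
  have hcovers (v : Λ) {A B : MergeTree (K.quotientSublevel f Λ₀)} (h : B.Covers A) :
      (v +ᵥ B).Covers (v +ᵥ A) :=
    h.map _ _ monotone_quotientSublevel monotone_quotientSublevel
  refine ⟨fun h => ?_, hcovers u⟩
  simpa only [neg_vadd_vadd] using hcovers (-u) h

theorem continuousConstVAdd_translationAction (Λ₀ : Submodule ℤ (EuclideanSpace ℝ (Fin d))) :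
    letI := hf.translationAction Λ₀
    ContinuousConstVAdd Λ (MergeTree (K.quotientSublevel f Λ₀)) :=
  letI := hf.translationAction Λ₀
  ⟨fun _ => MergeTree.continuous_map _ _⟩

/-- Translation by a vector of `Λ`, as a homeomorphism of the merge tree of `f/Λ₀`. -/
def translationHomeomorph (Λ₀ : Submodule ℤ (EuclideanSpace ℝ (Fin d))) (u : Λ) :
    MergeTree (K.quotientSublevel f Λ₀) ≃ₜ MergeTree (K.quotientSublevel f Λ₀) :=
  letI := hf.translationAction Λ₀
  haveI := hf.continuousConstVAdd_translationAction Λ₀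
  Homeomorph.vadd u

/-- Translation by a vector of `Λ`, as an automorphism of the decorated merge tree of `f/Λ₀`. -/
def translationIso (hle : Λ₀ ≤ Λ) (u : Λ) :
    (decoratedMergeTree K f Λ₀).Iso (decoratedMergeTree K f Λ₀) where
  toHomeomorph := hf.translationHomeomorph Λ₀ u
  height_apply := hf.height_vadd u
  covers_iff := hf.covers_vadd_iff u
  freq_apply := hf.shadowMonomial_component_vadd hle u

end CellComplex.IsPeriodicFilter

theorem splinters_of_relIndex_ne_zero [DiscreteTopology Λ] (hf : K.IsPeriodicFilter f Λ)
    (hle : Λ₀ ≤ Λ) (hi : Λ₀.toAddSubgroup.relIndex Λ.toAddSubgroup ≠ 0) :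
    Splinters (decoratedMergeTree K f Λ₀) (decoratedMergeTree K f Λ) := by
  refine splinters_of_transitive (ω := projTree K f hle) (continuous_projTree hle)
    (surjective_projTree hle) (MergeTree.height_map _ _) MergeTree.covers_refl
    (hf.finite_preimage_projTree hle hi) (fun A B hAB => ?_) (hf.image_projTree_setOf_covers hle)
    (hf.shadowMonomial_component_eq_divNat hle hi)
  obtain ⟨u, hu⟩ := (hf.preimage_projTree_eq_orbit hle A).subset hAB.symm
  exact ⟨hf.translationIso hle u, hu⟩

theorem equivalent_perMTree {L₁ L₂ : Submodule ℤ (EuclideanSpace ℝ (Fin d))}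
    [DiscreteTopology L₁] [IsZLattice ℝ L₁] [DiscreteTopology L₂] [IsZLattice ℝ L₂]
    [DiscreteTopology (L₁ ⊓ L₂ : Submodule ℤ (EuclideanSpace ℝ (Fin d)))]
    [IsZLattice ℝ (L₁ ⊓ L₂)]
    (hf₁ : K.IsPeriodicFilter f L₁) (hf₂ : K.IsPeriodicFilter f L₂) :
    Equivalent (perMTree K f L₁ hf₁) (perMTree K f L₂ hf₂) :=
  ⟨perMTree K f (L₁ ⊓ L₂) (hf₁.mono inf_le_left),
    splinters_of_relIndex_ne_zero hf₁ inf_le_left (relIndex_ne_zero_of_isZLattice inf_le_left),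
    splinters_of_relIndex_ne_zero hf₂ inf_le_right (relIndex_ne_zero_of_isZLattice inf_le_right)⟩

end PeriodicMerge

open PeriodicMerge in
theorem mainTheorem1 {d : ℕ} (K : CellComplex d) (f : K.cells → ℝ)
    (Λ Λ' Λ'' : Submodule ℤ (EuclideanSpace ℝ (Fin d)))
    [DiscreteTopology Λ] [IsZLattice ℝ Λ]
    [DiscreteTopology Λ'] [IsZLattice ℝ Λ'] [DiscreteTopology Λ''] [IsZLattice ℝ Λ'']
    (hf : K.IsPeriodicFilter f Λ) (hΛ' : Λ' ≤ Λ) (hΛ'' : Λ'' ≤ Λ) :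
    Equivalent (perMTree K f Λ' (hf.mono hΛ')) (perMTree K f Λ'' (hf.mono hΛ'')) ∧
      interleavingPseudoDist (equivClass (perMTree K f Λ' (hf.mono hΛ')))
        (equivClass (perMTree K f Λ'' (hf.mono hΛ''))) = 0 := by
  have := discreteTopology_of_le (inf_le_left : Λ' ⊓ Λ'' ≤ Λ')
  have := isZLattice_inf hΛ' hΛ''
  have hequiv := equivalent_perMTree (hf.mono hΛ') (hf.mono hΛ'')
  exact ⟨hequiv, interleavingPseudoDist_equivClass_eq_zero hequiv⟩
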